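/- Let $H$ be the parity check matrix (over $\mathbb{F}_2$, $m\times n$) of an arbitrary finite binary code, with Tanner graph joining check node $c$ and bit $k$ iff $H_{ck}=1$. Let the bits be erased independently with probability $\epsilon$ and let $x_k\in\{0,1\}$ indicate whether bit $k$ is erased. With messages $f_{i\to c,1}=x_i$, $f_{i\to c,l+1}=x_i\prod_{d\ni i,\,d\neq c}\ \sum_{k\in d,\,k\ne i}f_{k\to d,l}$ (Boolean AND as product, OR as sum) the iterative decoder of bit $i$ after $l\ge 1$ iterations is $f_{i,l}=x_i\prod_{d\ni i}\sum_{k\in d,\,k\neq i}f_{k\to d,l}$; let $f_i=\lim_{l\to\infty}f_{i,l}$ and $p_i(\epsilon)=\mathsf{E}\{f_i\}$. Consider the following algorithm for the target bit $i$. Its trees have variable nodes (AND) and check nodes (OR). Start with the tree $\mathcal T$ consisting of a single leaf variable node $x_i$, and repeat: 1. A leaf-finding module, which is arbitrary, selects a leaf variable node, of bit $j$ say; here a leaf is a variable node whose children have not been constructed yet. 2. If its channel input is still $x_j$ (it has not been hardwired to a constant) and $\mathcal T$ contains a non-leaf $x_j$ (a constructed variable node with an attached channel input $x_j$ that is not hardwired),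 let $v$ be the youngest node of $\mathcal T$ that is an ancestor of the leaf and is also an ancestor of, or equal to, some non-leaf $x_j$. If $v$ is a check node, do nothing special. If $v$ is a variable node, pivot at $v$: replace the subtree $f_v$ by $f_v|_{x_j=0}+x_j\cdot f_v|_{x_j=1}$, i.e. by an OR node over two copies of the subtree, all channel inputs $x_j$ being hardwired to $0$ in the first copy and to $1$ in the second, whose top AND node receives $x_j$ as an additional channel input. 3. Construct the check node children and variable node grandchildren of the selected leaf (of its two copies if a pivoting took place) as in the support tree of the Tanner graph: all checks of $j$ except the parent check, and for each of them all its bits except $j$. The loop stops after the first pass at whose end the number of nodes of $\mathcal T$ exceeds a preset limit or no leaf is left. Then all remaining leaves are set to $1$, except those already hardwired to $0$ by a pivoting, and $\mathrm{UB}_i(\epsilon)$ is computed from the leaves to the root as if all incoming edges were independent: each channel input not hardwired has probability $\epsilon$, one hardwired to $b\in\{0,1\}$ has probability $b$, an AND node has the product of the probabilities of its inputs and children, and an OR node has $1-\prod_a(1-q_a)$, where the $q_a$ are the probabilities of its children. Theorem. For every finite code, every bit $i$ and every leaf-finding module, the algorithm stops after finitely many passes for every size limit, and the tree obtained after any number of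 passes (in particular the final one) satisfies $p_i(\epsilon)\le \mathrm{UB}_i(\epsilon)$ for all $\epsilon\in[0,1]$. -/

import Mathlib

open Filter Topology

/-! ### The iterative decoder on the binary erasure channel

A code is given by its parity check matrix `H`: rows are check nodes, columns are variable nodes.
An erasure pattern is a map `x : Fin n → Bool`, `true` meaning "erased". -/

/-- Bit `k` takes part in check `c`, i.e. they are joined by an edge of the Tanner graph. -/
def Adj {m n : ℕ} (H : Matrix (Fin m) (Fin n) (ZMod 2)) (c : Fin m) (k : Fin n) : Prop :=
  H c k = 1

instance {m n : ℕ} (H : Matrix (Fin m) (Fin n) (ZMod 2)) (c : Fin m) (k : Fin n) :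
    Decidable (Adj H c k) :=
  inferInstanceAs (Decidable (H c k = 1))

/-- Message from variable node `i` to check node `c`.  The message of the first iteration
(`l = 0` here) is the channel output; afterwards a variable node sends AND of the channel output
and of the messages from its other checks, and a check node sends OR of the messages from its
other variables. -/
def varMsg {m n : ℕ} (H : Matrix (Fin m) (Fin n) (ZMod 2)) :
    ℕ → Fin n → Fin m → (Fin n → Bool) → Bool
  | 0, i, _, x => x i
  | l + 1, i, c, x => x i && decide (∀ d, Adj H d i → d ≠ c →
      ∃ k, Adj H d k ∧ k ≠ i ∧ varMsg H l k d x = true)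

/-- The decoder `f_{i,l}` of bit `i` after `l` iterations (`true`: bit `i` is still erased). -/
def decoderIter {m n : ℕ} (H : Matrix (Fin m) (Fin n) (ZMod 2)) (i : Fin n) :
    ℕ → (Fin n → Bool) → Bool
  | 0, x => x i
  | l + 1, x => x i && decide (∀ d, Adj H d i →
      ∃ k, Adj H d k ∧ k ≠ i ∧ varMsg H l k d x = true)

open Classical in
/-- The final decoder `f_i = lim_{l → ∞} f_{i,l}` (see `tendsto_decoderIter`). -/
noncomputable def decoder {m n : ℕ} (H : Matrix (Fin m) (Fin n) (ZMod 2)) (i : Fin n)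
    (x : Fin n → Bool) : Bool :=
  decide (∀ᶠ l in atTop, decoderIter H i l x = true)

theorem varMsg_anti {m n : ℕ} (H : Matrix (Fin m) (Fin n) (ZMod 2)) (x : Fin n → Bool) (l : ℕ) :
    ∀ i c, varMsg H (l + 1) i c x = true → varMsg H l i c x = true := by
  induction l with
  | zero => intro i c h; simp only [varMsg, Bool.and_eq_true] at h ⊢; exact h.1
  | succ l ih =>
    intro i c h
    rw [varMsg, Bool.and_eq_true, decide_eq_true_eq] at h ⊢
    refine ⟨h.1, fun d hd hdc => ?_⟩
    obtain ⟨k, hk, hki, hm⟩ := h.2 d hd hdc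
    exact ⟨k, hk, hki, ih k d hm⟩

theorem decoderIter_anti {m n : ℕ} (H : Matrix (Fin m) (Fin n) (ZMod 2)) (i : Fin n)
    (x : Fin n → Bool) (l : ℕ) :
    decoderIter H i (l + 1) x = true → decoderIter H i l x = true := by
  intro h
  cases l with
  | zero => simp only [decoderIter, Bool.and_eq_true] at h ⊢; exact h.1
  | succ l =>
    rw [decoderIter, Bool.and_eq_true, decide_eq_true_eq] at h ⊢
    refine ⟨h.1, fun d hd => ?_⟩
    obtain ⟨k, hk, hki, hm⟩ := h.2 d hd
    exact ⟨k, hk, hki, varMsg_anti H x l k d hm⟩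

theorem tendsto_decoderIter {m n : ℕ} (H : Matrix (Fin m) (Fin n) (ZMod 2)) (i : Fin n)
    (x : Fin n → Bool) :
    Tendsto (fun l => decoderIter H i l x) atTop (𝓝 (decoder H i x)) := by
  rw [nhds_discrete, tendsto_pure]
  by_cases h : ∀ᶠ l in atTop, decoderIter H i l x = true
  · filter_upwards [h] with l hl
    simp [decoder, h, hl]
  · have h' : ∃ l, decoderIter H i l x = false := by
      by_contra hc
      push Not at hc
      exact h (Eventually.of_forall fun l => by simpa using hc l)
    obtain ⟨l₀, hl₀⟩ := h'
    filter_upwards [eventually_ge_atTop l₀] with l hl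
    have : decoderIter H i l x = false := by
      induction l, hl using Nat.le_induction with
      | base => exact hl₀
      | succ l _ ih =>
        by_contra hc
        have := decoderIter_anti H i x l (by simpa using hc)
        simp [ih] at this
    simp [decoder, h, this]

/-- `E{f}`: the probability of `f = 1` when every bit is erased independently with
probability `ε`. -/
noncomputable def becExpect {n : ℕ} (ε : ℝ) (f : (Fin n → Bool) → Bool) : ℝ :=
  ∑ x : Fin n → Bool, (∏ k, if x k = true then ε else 1 - ε) * (if f x = true then 1 else 0)

/-- The bit erasure probability `p_i = E{f_i}`. -/
noncomputable def bitErasureProb {m n : ℕ} (H : Matrix (Fin m) (Fin n) (ZMod 2)) (i : Fin n)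
    (ε : ℝ) : ℝ :=
  becExpect ε (decoder H i)

/-! ### Trees of variable nodes (AND) and check nodes (OR) -/

/-- A channel input: the bit it belongs to, and `none` if it is the live bit `x_j`,
`some b` if it has been hardwired to the constant `b`. -/
abbrev Input (n : ℕ) : Type := Fin n × Option Bool

/-- * `leaf j par w`: a leaf variable node of bit `j` whose subtree is not revealed yet, with its
  parent check in the Tanner graph (`none` for the root) and its channel input `(j, w)`;
* `var ins k ch`: a revealed (non-leaf) variable node, AND of the channel inputs `ins` attached to
  it and of its `k` children;
* `chk k ch`: a check node, OR of its `k` children. -/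
inductive DTree (n m : ℕ) : Type
  | leaf (j : Fin n) (par : Option (Fin m)) (w : Option Bool) : DTree n m
  | var (ins : List (Input n)) (k : ℕ) (ch : Fin k → DTree n m) : DTree n m
  | chk (k : ℕ) (ch : Fin k → DTree n m) : DTree n m

namespace DTree

/-- Number of nodes. -/
def size {n m : ℕ} : DTree n m → ℕ
  | leaf _ _ _ => 1
  | var _ _ ch => 1 + ∑ a, (ch a).size
  | chk _ ch => 1 + ∑ a, (ch a).size

/-- The subtree at an address (the list of child indices on the way down from the root). -/
def sub {n m : ℕ} : DTree n m → List ℕ → Option (DTree n m)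
  | T, [] => some T
  | leaf _ _ _, _ :: _ => none
  | var _ k ch, a :: p => if h : a < k then (ch ⟨a, h⟩).sub p else none
  | chk k ch, a :: p => if h : a < k then (ch ⟨a, h⟩).sub p else none

/-- Replace the subtree `S` at an address by `F S`. -/
def modifyAt {n m : ℕ} (F : DTree n m → DTree n m) : List ℕ → DTree n m → DTree n m
  | [], T => F T
  | _ :: _, leaf j par w => leaf j par w
  | a :: p, var ins k ch => var ins k (fun b => if b.val = a then modifyAt F p (ch b) else ch b)
  | a :: p, chk k ch => chk k (fun b => if b.val = a then modifyAt F p (ch b) else ch b)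

/-- There is a leaf at address `p`. -/
def IsLeafAt {n m : ℕ} (T : DTree n m) (p : List ℕ) : Prop :=
  ∃ j par w, T.sub p = some (leaf j par w)

/-- The tree contains a non-leaf `x_j`, i.e. a live channel input `x_j` of a revealed node. -/
def occurs {n m : ℕ} (j : Fin n) : DTree n m → Bool
  | leaf _ _ _ => false
  | var ins _ ch => decide ((j, none) ∈ ins) || decide (∃ a, (ch a).occurs j = true)
  | chk _ ch => decide (∃ a, (ch a).occurs j = true)

/-- `yca(x_j)`: the youngest ancestor of the node at address `p` that is also an ancestor of (or
equal to) some non-leaf `x_j`; `none` if the tree contains no non-leaf `x_j`.  The ancestors of `p`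
are the initial segments of `p`, and they are tried from the longest to the shortest. -/
def yca {n m : ℕ} (T : DTree n m) (j : Fin n) (p : List ℕ) : Option (List ℕ) :=
  p.inits.reverse.find? fun r =>
    match T.sub r with
    | some S => S.occurs j
    | none => false

/-- Hardwire a channel input to `b` if it is a live `x_j`. -/
def wireInput {n : ℕ} (j : Fin n) (b : Bool) : Input n → Input n
  | (k, none) => if k = j then (k, some b) else (k, none)
  | (k, some b') => (k, some b')

/-- Hardwire all live inputs `x_j` of the tree (at leaves and at non-leaf nodes) to `b`. -/
def hardwire {n m : ℕ} (j : Fin n) (b : Bool) : DTree n m → DTree n m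
  | leaf k par w => leaf k par (wireInput j b (k, w)).2
  | var ins k ch => var (ins.map (wireInput j b)) k (fun a => (ch a).hardwire j b)
  | chk k ch => chk k (fun a => (ch a).hardwire j b)

/-- The pivoting construction at a variable node `v`: `f_v` is replaced by
`f_v|_{x_j = 0} + x_j · f_v|_{x_j = 1}`.  The subtree is duplicated, the two copies (with `x_j`
hardwired to `0` and `1`) become the children of a new OR node, and a live input `x_j` is
attached to the AND node at the root of the second copy. -/
def pivot {n m : ℕ} (j : Fin n) : DTree n m → DTree n m
  | var ins k ch => chk 2 ![(var ins k ch).hardwire j false,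
      var ((j, none) :: ins.map (wireInput j true)) k (fun a => (ch a).hardwire j true)]
  | T => T

/-- Reveal a leaf: attach its check node children and variable node grandchildren as in the
support tree of the Tanner graph (all checks of `j` except the parent check, and for each such
check all its bits except `j`). -/
def expand {n m : ℕ} (H : Matrix (Fin m) (Fin n) (ZMod 2)) : DTree n m → DTree n m
  | leaf j par w =>
    let cs := (List.finRange m).filter fun c => decide (Adj H c j ∧ par ≠ some c)
    var [(j, w)] cs.length fun a =>
      let ks := (List.finRange n).filter fun k => decide (Adj H (cs.get a) k ∧ k ≠ j)
      chk ks.length fun b => leaf (ks.get b) (some (cs.get a)) none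
  | T => T

/-- One pass of the loop, for the leaf at address `p`.  A leaf whose input has been hardwired is
no longer an `x_j`, so that it needs no rule. -/
def step {n m : ℕ} (H : Matrix (Fin m) (Fin n) (ZMod 2)) (p : List ℕ) (T : DTree n m) :
    DTree n m :=
  match T.sub p with
  | some (leaf j _ none) =>
    match T.yca j p with
    | none => modifyAt (expand H) p T
    | some r =>
      match T.sub r with
      | some (var _ _ _) => modifyAt (pivot j) r (modifyAt (expand H) p T)
      | _ => modifyAt (expand H) p T
  | some (leaf _ _ (some _)) => modifyAt (expand H) p T
  | _ => T

/-- The probability that a channel input equals `1`. -/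
def inputProb {n : ℕ} (ε : ℝ) : Input n → ℝ
  | (_, none) => ε
  | (_, some true) => 1
  | (_, some false) => 0

/-- The value of the bound: the remaining leaves are hardwired to `1` (unless already hardwired to
`0` by a pivoting), and at every node the incoming edges are treated as independent. -/
noncomputable def ub {n m : ℕ} (ε : ℝ) : DTree n m → ℝ
  | leaf _ _ (some false) => 0
  | leaf _ _ _ => 1
  | var ins _ ch => (ins.map (inputProb ε)).prod * ∏ a, (ch a).ub ε
  | chk _ ch => 1 - ∏ a, (1 - (ch a).ub ε)

end DTree

/-! ### The algorithm -/

/-- A leaf-finding module: given the time and the current tree it returns an address, and this is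
the address of a leaf whenever there is one.  (As the time is an argument, every order in which
leaves may be chosen is covered.) -/
structure LeafFinder (n m : ℕ) where
  find : ℕ → DTree n m → List ℕ
  isLeafAt_find : ∀ (t : ℕ) (T : DTree n m), (∃ p, T.IsLeafAt p) → T.IsLeafAt (find t T)

/-- The tree after `t` passes of the loop, started from the target variable node `x_i` alone. -/
def treeAt {m n : ℕ} (H : Matrix (Fin m) (Fin n) (ZMod 2)) (i : Fin n) (L : LeafFinder n m) :
    ℕ → DTree n m
  | 0 => DTree.leaf i none none
  | t + 1 => DTree.step H (L.find t (treeAt H i L t)) (treeAt H i L t)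

/-- After `t` passes the size exceeds the preset limit, or no leaf is left. -/
def StopCond {m n : ℕ} (H : Matrix (Fin m) (Fin n) (ZMod 2)) (i : Fin n) (L : LeafFinder n m)
    (limit t : ℕ) : Prop :=
  limit < (treeAt H i L t).size ∨ ¬ ∃ p, (treeAt H i L t).IsLeafAt p

/-- The repeat-until loop stops after exactly `t` passes. -/
def StopsAt {m n : ℕ} (H : Matrix (Fin m) (Fin n) (ZMod 2)) (i : Fin n) (L : LeafFinder n m)
    (limit t : ℕ) : Prop :=
  1 ≤ t ∧ StopCond H i L limit t ∧ ∀ s, 1 ≤ s → s < t → ¬ StopCond H i L limit s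

/-!
Two facts give the bound; both compare a tree with an erasure pattern `x`.

*The tree dominates the decoder.* Put below every unrevealed leaf the limits of the messages
entering it (`DTree.Holds`). Initially the tree then is at least the decoder `f_i`. Revealing a leaf
keeps the property, because the limiting messages satisfy the message recursion
(`DTree.Holds.expand`). Pivoting keeps it as well, because hardwiring `x_j` to its actual value
changes nothing, so that one of the two copies has the value of the old subtree
(`DTree.Holds.pivot`). Since AND and OR are increasing, changes of a subtree carry over to the root.
Setting the leaves to `1`, except those wired to `0`, only raises the value
(`DTree.value_eq_one`).

*The expectation of the tree is at most `ub`.* The algorithm keeps the live inputs and children of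
every AND node free of common bits (`DTree.Decoupled.step`). Let `v` be the node returned by `yca`
for a leaf `x_j`. Strictly below `v`, on the way to the leaf, `x_j` is new; the subtrees at `v` and
at its ancestors keep their sets of live bits; and `v` itself is an OR node, on which no condition
is imposed, or becomes one through the pivot, whose copies contain `x_j` only as one input at the
top of the second copy. Hence the inputs of an AND node are independent (`realExpect_mul`), while
those of an OR node are increasing functions of `x` and positively correlated by Harris' inequality,
a case of the FKG inequality (`realExpect_mul_one_sub_le`), so that treating them as independent
overestimates the OR.

For termination, every pass raises `DTree.weight`, which is at most twice the size.
-/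

/-! ### Addresses and subtrees -/

namespace DTree

variable {n m : ℕ}

theorem sub_var_cons {ins : List (Input n)} {k : ℕ} {ch : Fin k → DTree n m} {a : ℕ}
    {p : List ℕ} {S : DTree n m} :
    (var ins k ch).sub (a :: p) = some S ↔ ∃ h : a < k, (ch ⟨a, h⟩).sub p = some S := by
  rw [sub]
  split <;> simp_all

theorem sub_chk_cons {k : ℕ} {ch : Fin k → DTree n m} {a : ℕ} {p : List ℕ} {S : DTree n m} :
    (chk k ch).sub (a :: p) = some S ↔ ∃ h : a < k, (ch ⟨a, h⟩).sub p = some S := by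
  rw [sub]
  split <;> simp_all

theorem sub_append (T : DTree n m) (r q : List ℕ) : T.sub (r ++ q) = (T.sub r).bind (sub · q) := by
  induction r generalizing T with
  | nil => cases T <;> simp [sub]
  | cons a r ih =>
    cases T with
    | leaf => simp [sub]
    | var => simp only [List.cons_append, sub]; split <;> simp [ih]
    | chk => simp only [List.cons_append, sub]; split <;> simp [ih]

theorem modifyAt_append (F : DTree n m → DTree n m) (r q : List ℕ) (T : DTree n m) :
    modifyAt F (r ++ q) T = modifyAt (modifyAt F q) r T := by
  induction r generalizing T with
  | nil => simp [modifyAt]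
  | cons a r ih =>
    cases T with
    | leaf => simp [modifyAt]
    | var | chk =>
      simp only [List.cons_append, modifyAt, var.injEq, chk.injEq, heq_eq_eq, true_and]
      funext b; split <;> simp [ih]

theorem modifyAt_modifyAt (F G : DTree n m → DTree n m) (r : List ℕ) (T : DTree n m) :
    modifyAt F r (modifyAt G r T) = modifyAt (fun S => F (G S)) r T := by
  induction r generalizing T with
  | nil => simp [modifyAt]
  | cons a r ih =>
    cases T with
    | leaf => simp [modifyAt]
    | var | chk =>
      simp only [modifyAt, var.injEq, chk.injEq, heq_eq_eq, true_and]
      funext b; split <;> simp [ih]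

theorem occurs_var {j : Fin n} {ins : List (Input n)} {k : ℕ} {ch : Fin k → DTree n m} :
    (var ins k ch).occurs j = true ↔ (j, none) ∈ ins ∨ ∃ a, (ch a).occurs j = true := by
  simp [occurs]

theorem occurs_chk {j : Fin n} {k : ℕ} {ch : Fin k → DTree n m} :
    (chk k ch).occurs j = true ↔ ∃ a, (ch a).occurs j = true := by
  simp [occurs]

/-! ### Growth of the tree -/

/-- A weight that counts leaves once and all other nodes twice, so that it grows even when a
revealed leaf turns out to have no children. -/
def weight : DTree n m → ℕ
  | leaf _ _ _ => 1
  | var _ _ ch => 2 + ∑ a, (ch a).weight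
  | chk _ ch => 2 + ∑ a, (ch a).weight

theorem weight_le (T : DTree n m) : T.weight ≤ 2 * T.size := by
  induction T with
  | leaf => simp [weight, size]
  | var _ _ _ ih =>
    have := Finset.sum_le_sum fun a (_ : a ∈ Finset.univ) => ih a
    rw [← Finset.mul_sum] at this
    simp only [weight, size]; omega
  | chk _ _ ih =>
    have := Finset.sum_le_sum fun a (_ : a ∈ Finset.univ) => ih a
    rw [← Finset.mul_sum] at this
    simp only [weight, size]; omega

theorem weight_hardwire (j : Fin n) (b : Bool) (T : DTree n m) :
    (T.hardwire j b).weight = T.weight := by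
  induction T with
  | leaf => rfl
  | var _ _ _ ih => simp [hardwire, weight, ih]
  | chk _ _ ih => simp [hardwire, weight, ih]

theorem weight_le_pivot (j : Fin n) (T : DTree n m) : T.weight ≤ (T.pivot j).weight := by
  cases T with
  | leaf => rfl
  | chk => rfl
  | var ins k ch =>
    have := weight_hardwire j false (var ins k ch)
    simp only [pivot, weight, Fin.sum_univ_two, Matrix.cons_val_zero] at this ⊢
    omega

theorem weight_le_modifyAt {F : DTree n m → DTree n m} (hF : ∀ S, S.weight ≤ (F S).weight)
    (p : List ℕ) (T : DTree n m) : T.weight ≤ (modifyAt F p T).weight := by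
  induction p generalizing T with
  | nil => simpa [modifyAt] using hF T
  | cons a p ih =>
    cases T with
    | leaf => rfl
    | var | chk =>
      simp only [modifyAt, weight]
      gcongr
      split
      exacts [ih _, le_rfl]

theorem weight_lt_modifyAt {F : DTree n m → DTree n m} {p : List ℕ} {T S : DTree n m}
    (hs : T.sub p = some S) (hF : S.weight < (F S).weight) :
    T.weight < (modifyAt F p T).weight := by
  induction p generalizing T with
  | nil => cases T <;> simp_all [sub, modifyAt]
  | cons a p ih =>
    cases T with
    | leaf => simp [sub] at hs
    | var =>
      obtain ⟨h, hs⟩ := sub_var_cons.1 hs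
      simp only [modifyAt, weight]
      refine Nat.add_lt_add_left (Finset.sum_lt_sum (fun b _ => ?_) ⟨⟨a, h⟩, by simp, ?_⟩) _
      · split
        · obtain rfl : b = ⟨a, h⟩ := Fin.ext (by assumption)
          exact (ih hs).le
        · rfl
      · simpa using ih hs
    | chk =>
      obtain ⟨h, hs⟩ := sub_chk_cons.1 hs
      simp only [modifyAt, weight]
      refine Nat.add_lt_add_left (Finset.sum_lt_sum (fun b _ => ?_) ⟨⟨a, h⟩, by simp, ?_⟩) _
      · split
        · obtain rfl : b = ⟨a, h⟩ := Fin.ext (by assumption)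
          exact (ih hs).le
        · rfl
      · simpa using ih hs

theorem weight_lt_step (H : Matrix (Fin m) (Fin n) (ZMod 2)) {p : List ℕ} {T : DTree n m}
    (hp : T.IsLeafAt p) : T.weight < (T.step H p).weight := by
  obtain ⟨j, par, w, hs⟩ := hp
  have h1 : T.weight < (modifyAt (expand H) p T).weight :=
    weight_lt_modifyAt hs (by simp only [expand, weight]; omega)
  unfold step
  rw [hs]
  cases w with
  | some => exact h1
  | none =>
    dsimp only
    split
    · exact h1
    · split
      · exact h1.trans_le (weight_le_modifyAt (weight_le_pivot j) _ _)
      · exact h1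

/-! ### The tree dominates the decoder pointwise -/

/-- The value of a channel input under the erasure pattern `x`. -/
def inputVal (x : Fin n → Bool) (u : Input n) : Bool := u.2.getD (x u.1)

/-- The tree evaluates to `1` under the erasure pattern `x`, where the part of the support tree
hidden below an unrevealed leaf is represented by the limits of the messages that enter it: a
message sequence is decreasing, so its limit is `1` iff all its terms are. -/
def Holds (H : Matrix (Fin m) (Fin n) (ZMod 2)) (x : Fin n → Bool) : DTree n m → Prop
  | leaf j par w => inputVal x (j, w) = true ∧ ∀ d, Adj H d j → par ≠ some d →
      ∃ k, Adj H d k ∧ k ≠ j ∧ ∀ l, varMsg H l k d x = true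
  | var ins _ ch => (∀ u ∈ ins, inputVal x u = true) ∧ ∀ a, (ch a).Holds H x
  | chk _ ch => ∃ a, (ch a).Holds H x

/-- Over a finite index set, a decreasing sequence of nonempty sets has a common element. -/
theorem exists_forall_of_forall_exists {n : ℕ} {P : ℕ → Fin n → Prop}
    (hP : ∀ l k, P (l + 1) k → P l k) (h : ∀ l, ∃ k, P l k) : ∃ k, ∀ l, P l k := by
  by_contra! hc
  choose f hf using hc
  obtain ⟨k, hk⟩ := h (Finset.univ.sup f)
  have hanti : ∀ l l', l ≤ l' → P l' k → P l k := by
    intro l l' hl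
    induction l', hl using Nat.le_induction with
    | base => exact id
    | succ l' _ ih => exact fun h => ih (hP _ _ h)
  exact hf k (hanti _ _ (Finset.le_sup (Finset.mem_univ k)) hk)

/-- The limiting messages are a fixed point of the message recursion: they can be unfolded once. -/
theorem holds_leaf_of_varMsg {H : Matrix (Fin m) (Fin n) (ZMod 2)} {x : Fin n → Bool} {j : Fin n}
    {c : Fin m} (h : ∀ l, varMsg H l j c x = true) : (leaf j (some c) none).Holds H x := by
  refine ⟨h 0, fun d hd hdc => ?_⟩
  obtain ⟨k, hk⟩ := exists_forall_of_forall_exists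
    (P := fun l k => Adj H d k ∧ k ≠ j ∧ varMsg H l k d x = true)
    (fun l k hk => ⟨hk.1, hk.2.1, varMsg_anti H x l k d hk.2.2⟩) (fun l => by
      have := h (l + 1)
      rw [varMsg, Bool.and_eq_true, decide_eq_true_eq] at this
      exact this.2 d hd fun e => hdc (by rw [e]))
  exact ⟨k, (hk 0).1, (hk 0).2.1, fun l => (hk l).2.2⟩

theorem holds_leaf_of_decoder {H : Matrix (Fin m) (Fin n) (ZMod 2)} {x : Fin n → Bool} {i : Fin n}
    (h : decoder H i x = true) : (leaf i none none : DTree n m).Holds H x := by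
  simp only [decoder, decide_eq_true_eq, eventually_atTop] at h
  obtain ⟨N, hN⟩ := h
  have hall : ∀ l, decoderIter H i l x = true := fun l => by
    rcases le_total N l with hl | hl
    · exact hN l hl
    · have : decoderIter H i N x = true := hN N le_rfl
      induction N, hl using Nat.le_induction with
      | base => exact this
      | succ N' hl ih =>
        have h' := decoderIter_anti H i x N' this
        refine ih (fun b hb => ?_) h'
        rcases hb.eq_or_lt with rfl | hb
        exacts [h', hN b hb]
  refine ⟨hall 0, fun d hd _ => ?_⟩
  obtain ⟨k, hk⟩ := exists_forall_of_forall_exists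
    (P := fun l k => Adj H d k ∧ k ≠ i ∧ varMsg H l k d x = true)
    (fun l k hk => ⟨hk.1, hk.2.1, varMsg_anti H x l k d hk.2.2⟩) (fun l => by
      have := hall (l + 1)
      rw [decoderIter, Bool.and_eq_true, decide_eq_true_eq] at this
      exact this.2 d hd)
  exact ⟨k, (hk 0).1, (hk 0).2.1, fun l => (hk l).2.2⟩

theorem Holds.expand {H : Matrix (Fin m) (Fin n) (ZMod 2)} {x : Fin n → Bool} {T : DTree n m}
    (h : T.Holds H x) : (T.expand H).Holds H x := by
  cases T with
  | var | chk => exact h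
  | leaf j par w =>
    refine ⟨by simpa using h.1, fun a => ?_⟩
    have ha := List.get_mem _ a
    simp only [List.mem_filter, List.mem_finRange, true_and, decide_eq_true_eq] at ha
    obtain ⟨k, hk, hkj, hm⟩ := h.2 _ ha.1 ha.2
    have hmem : k ∈ (List.finRange n).filter fun k => decide (Adj H (((List.finRange m).filter
        fun c => decide (Adj H c j ∧ par ≠ some c)).get a) k ∧ k ≠ j) := by
      simp only [List.mem_filter, List.mem_finRange, true_and, decide_eq_true_eq]
      exact ⟨hk, hkj⟩
    obtain ⟨b, hb⟩ := List.get_of_mem hmem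
    refine ⟨b, ?_⟩
    dsimp only
    rw [hb]
    exact holds_leaf_of_varMsg hm

theorem inputVal_wireInput (x : Fin n → Bool) (j : Fin n) (u : Input n) :
    inputVal x (wireInput j (x j) u) = inputVal x u := by
  obtain ⟨k, _ | b⟩ := u
  · by_cases h : k = j <;> simp [wireInput, inputVal, h]
  · rfl

theorem wireInput_fst (j : Fin n) (b : Bool) (u : Input n) : (wireInput j b u).1 = u.1 := by
  obtain ⟨k, _ | b⟩ := u
  · by_cases h : k = j <;> simp [wireInput, h]
  · rfl

/-- Hardwiring `x_j` to its actual value changes nothing. -/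
theorem holds_hardwire (H : Matrix (Fin m) (Fin n) (ZMod 2)) (x : Fin n → Bool) (j : Fin n)
    (T : DTree n m) : (T.hardwire j (x j)).Holds H x ↔ T.Holds H x := by
  induction T with
  | leaf k par w =>
    have : (k, (wireInput j (x j) (k, w)).2) = wireInput j (x j) (k, w) :=
      Prod.ext (wireInput_fst j (x j) (k, w)).symm rfl
    simp only [hardwire, Holds, this, inputVal_wireInput]
  | var ins k ch ih => simp only [hardwire, Holds, ih, List.forall_mem_map, inputVal_wireInput]
  | chk k ch ih => simp [hardwire, Holds, ih]

theorem Holds.pivot {H : Matrix (Fin m) (Fin n) (ZMod 2)} {x : Fin n → Bool} {T : DTree n m}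
    (j : Fin n) (h : T.Holds H x) : (T.pivot j).Holds H x := by
  cases T with
  | leaf | chk => exact h
  | var ins k ch =>
    rw [← holds_hardwire H x j] at h
    cases hx : x j with
    | false => rw [hx] at h; exact ⟨0, h⟩
    | true =>
      rw [hx] at h
      refine ⟨1, fun u hu => ?_, h.2⟩
      rcases List.mem_cons.1 hu with rfl | hu
      exacts [hx, h.1 u hu]

theorem Holds.modifyAt {H : Matrix (Fin m) (Fin n) (ZMod 2)} {x : Fin n → Bool}
    {F : DTree n m → DTree n m} (hF : ∀ S : DTree n m, S.Holds H x → (F S).Holds H x)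
    (p : List ℕ) {T : DTree n m} (h : T.Holds H x) : (modifyAt F p T).Holds H x := by
  induction p generalizing T with
  | nil => simpa [DTree.modifyAt] using hF T h
  | cons a p ih =>
    cases T with
    | leaf => exact h
    | var ins k ch =>
      refine ⟨h.1, fun b => ?_⟩
      dsimp only
      split
      exacts [ih (h.2 b), h.2 b]
    | chk _ ch =>
      obtain ⟨b, hb⟩ := h
      refine ⟨b, ?_⟩
      dsimp only
      split
      exacts [ih hb, hb]

theorem Holds.step {H : Matrix (Fin m) (Fin n) (ZMod 2)} {x : Fin n → Bool} (p : List ℕ)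
    {T : DTree n m} (h : T.Holds H x) : (T.step H p).Holds H x := by
  have h1 : (DTree.modifyAt (DTree.expand H) p T).Holds H x := h.modifyAt (fun _ => Holds.expand) p
  unfold DTree.step
  split
  · split
    · exact h1
    · split
      · exact h1.modifyAt (fun _ => Holds.pivot _) _
      · exact h1
  · exact h1
  · exact h

/-! ### Live inputs below an AND node stay disjoint -/

/-- No live bit is shared by two channel inputs or children of the same AND node.  Bits may be
shared by the children of an OR node, and unrevealed leaves do not count. -/
def Decoupled : DTree n m → Prop
  | leaf _ _ _ => True
  | var ins _ ch => (ins.Pairwise fun u v => u.2 = none → v.2 = none → u.1 ≠ v.1) ∧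
      (∀ j, (j, none) ∈ ins → ∀ a, ¬ (ch a).occurs j = true) ∧
      (∀ a b j, a ≠ b → (ch a).occurs j = true → ¬ (ch b).occurs j = true) ∧
      ∀ a, (ch a).Decoupled
  | chk _ ch => ∀ a, (ch a).Decoupled

theorem occurs_modifyAt {F : DTree n m → DTree n m} {r : List ℕ} {T S : DTree n m}
    (hs : T.sub r = some S) (hocc : ∀ k, (F S).occurs k = S.occurs k) (k : Fin n) :
    (modifyAt F r T).occurs k = T.occurs k := by
  induction r generalizing T with
  | nil => cases T <;> simp_all [sub, modifyAt]
  | cons a r ih =>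
    cases T with
    | leaf => simp [sub] at hs
    | var ins K ch =>
      obtain ⟨h, hs⟩ := sub_var_cons.1 hs
      have ho : ∀ b, (if b.val = a then modifyAt F r (ch b) else ch b).occurs k =
          (ch b).occurs k := fun b => by
        split
        · obtain rfl : b = ⟨a, h⟩ := Fin.ext (by assumption)
          exact ih hs
        · rfl
      simp only [modifyAt, occurs, ho]
    | chk K ch =>
      obtain ⟨h, hs⟩ := sub_chk_cons.1 hs
      have ho : ∀ b, (if b.val = a then modifyAt F r (ch b) else ch b).occurs k =
          (ch b).occurs k := fun b => by
        split
        · obtain rfl : b = ⟨a, h⟩ := Fin.ext (by assumption)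
          exact ih hs
        · rfl
      simp only [modifyAt, occurs, ho]

/-- Replacing a subtree by one with the same live bits keeps the ancestors decoupled. -/
theorem Decoupled.modifyAt {F : DTree n m → DTree n m} {r : List ℕ} {T S : DTree n m}
    (hs : T.sub r = some S) (hocc : ∀ k, (F S).occurs k = S.occurs k)
    (hF : S.Decoupled → (F S).Decoupled) (hT : T.Decoupled) : (modifyAt F r T).Decoupled := by
  induction r generalizing T with
  | nil => cases T <;> simp_all [sub, DTree.modifyAt]
  | cons a r ih =>
    cases T with
    | leaf => simp [sub] at hs
    | var ins k ch =>
      obtain ⟨h, hs⟩ := sub_var_cons.1 hs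
      have ho : ∀ b k', (if b.val = a then DTree.modifyAt F r (ch b) else ch b).occurs k' =
          (ch b).occurs k' := fun b k' => by
        split
        · obtain rfl : b = ⟨a, h⟩ := Fin.ext (by assumption)
          exact occurs_modifyAt hs hocc k'
        · rfl
      obtain ⟨h1, h2, h3, h4⟩ := hT
      refine ⟨h1, fun j hj b => by rw [ho]; exact h2 j hj b,
        fun b c j hbc => by rw [ho, ho]; exact h3 b c j hbc, fun b => ?_⟩
      dsimp only
      split
      · obtain rfl : b = ⟨a, h⟩ := Fin.ext (by assumption)
        exact ih hs (h4 _)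
      · exact h4 b
    | chk k ch =>
      obtain ⟨h, hs⟩ := sub_chk_cons.1 hs
      intro b
      dsimp only
      split
      · obtain rfl : b = ⟨a, h⟩ := Fin.ext (by assumption)
        exact ih hs (hT _)
      · exact hT b

theorem occurs_expand_leaf (H : Matrix (Fin m) (Fin n) (ZMod 2)) (j k : Fin n)
    (par : Option (Fin m)) (w : Option Bool) :
    ((leaf j par w).expand H).occurs k = true ↔ k = j ∧ w = none := by
  rw [expand, occurs_var]
  simp [occurs, eq_comm (a := w)]

theorem decoupled_expand_leaf (H : Matrix (Fin m) (Fin n) (ZMod 2)) (j : Fin n)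
    (par : Option (Fin m)) (w : Option Bool) : ((leaf j par w).expand H).Decoupled := by
  simp [expand, occurs, Decoupled]

theorem occurs_modifyAt_expand (H : Matrix (Fin m) (Fin n) (ZMod 2)) {j : Fin n}
    {par : Option (Fin m)} {w : Option Bool} {p : List ℕ} {T : DTree n m}
    (hs : T.sub p = some (leaf j par w)) (k : Fin n) :
    (modifyAt (expand H) p T).occurs k = true ↔ T.occurs k = true ∨ k = j ∧ w = none := by
  induction p generalizing T with
  | nil =>
    cases T <;> simp only [sub, Option.some.injEq, reduceCtorEq] at hs
    rw [hs, modifyAt, occurs_expand_leaf]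
    simp [occurs]
  | cons a p ih =>
    cases T with
    | leaf => simp [sub] at hs
    | var ins K ch =>
      obtain ⟨h, hs⟩ := sub_var_cons.1 hs
      rw [modifyAt, occurs_var, occurs_var, or_assoc]
      refine or_congr_right ⟨fun ⟨b, hb⟩ => ?_, ?_⟩
      · split at hb
        · obtain rfl : b = ⟨a, h⟩ := Fin.ext (by assumption)
          exact ((ih hs).1 hb).imp_left fun h => ⟨_, h⟩
        · exact .inl ⟨b, hb⟩
      · rintro (⟨b, hb⟩ | hw)
        · refine ⟨b, ?_⟩
          split
          · obtain rfl : b = ⟨a, h⟩ := Fin.ext (by assumption)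
            exact (ih hs).2 (.inl hb)
          · exact hb
        · exact ⟨⟨a, h⟩, by simpa using (ih hs).2 (.inr hw)⟩
    | chk K ch =>
      obtain ⟨h, hs⟩ := sub_chk_cons.1 hs
      rw [modifyAt, occurs_chk, occurs_chk]
      refine ⟨fun ⟨b, hb⟩ => ?_, ?_⟩
      · split at hb
        · obtain rfl : b = ⟨a, h⟩ := Fin.ext (by assumption)
          exact ((ih hs).1 hb).imp_left fun h => ⟨_, h⟩
        · exact .inl ⟨b, hb⟩
      · rintro (⟨b, hb⟩ | hw)
        · refine ⟨b, ?_⟩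
          split
          · obtain rfl : b = ⟨a, h⟩ := Fin.ext (by assumption)
            exact (ih hs).2 (.inl hb)
          · exact hb
        · exact ⟨⟨a, h⟩, by simpa using (ih hs).2 (.inr hw)⟩

/-- Revealing a leaf is harmless if it adds no live bit, or one that is new to the tree. -/
theorem Decoupled.modifyAt_expand (H : Matrix (Fin m) (Fin n) (ZMod 2)) {j : Fin n}
    {par : Option (Fin m)} {w : Option Bool} {p : List ℕ} {T : DTree n m}
    (hs : T.sub p = some (leaf j par w)) (hw : w = none → ¬ T.occurs j = true)
    (hT : T.Decoupled) : (DTree.modifyAt (DTree.expand H) p T).Decoupled := by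
  induction p generalizing T with
  | nil =>
    cases T <;> simp only [sub, Option.some.injEq, reduceCtorEq] at hs
    rw [hs, DTree.modifyAt]
    exact decoupled_expand_leaf H j par w
  | cons a p ih =>
    cases T with
    | leaf => simp [sub] at hs
    | var ins K ch =>
      obtain ⟨h, hs⟩ := sub_var_cons.1 hs
      have ho : ∀ b k', (if b.val = a then DTree.modifyAt (DTree.expand H) p (ch b) else ch b).occurs
          k' = true → (ch b).occurs k' = true ∨ (b = ⟨a, h⟩ ∧ k' = j ∧ w = none) := by
        intro b k' hb
        split at hb
        · obtain rfl : b = ⟨a, h⟩ := Fin.ext (by assumption)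
          exact ((occurs_modifyAt_expand H hs k').1 hb).imp_right fun h => ⟨rfl, h⟩
        · exact .inl hb
      rw [occurs_var, not_or, not_exists] at hw
      obtain ⟨h1, h2, h3, h4⟩ := hT
      refine ⟨h1, fun k' hk' b hb => ?_, fun b c k' hbc hb hc => ?_, fun b => ?_⟩
      · rcases ho b k' hb with hb | ⟨_, rfl, hwn⟩
        exacts [h2 k' hk' b hb, (hw hwn).1 hk']
      · rcases ho b k' hb with hb' | ⟨rfl, rfl, hwn⟩ <;>
          rcases ho c k' hc with hc' | ⟨rfl, hk, hwn'⟩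
        · exact h3 b c k' hbc hb' hc'
        · exact (hw hwn').2 b (hk ▸ hb')
        · exact (hw hwn).2 c hc'
        · exact hbc rfl
      · dsimp only
        split
        · obtain rfl : b = ⟨a, h⟩ := Fin.ext (by assumption)
          exact ih hs (fun hwn => (hw hwn).2 _) (h4 _)
        · exact h4 b
    | chk K ch =>
      obtain ⟨h, hs⟩ := sub_chk_cons.1 hs
      rw [occurs_chk, not_exists] at hw
      intro b
      dsimp only
      split
      · obtain rfl : b = ⟨a, h⟩ := Fin.ext (by assumption)
        exact ih hs (fun hwn => hw hwn _) (hT _)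
      · exact hT b

theorem wireInput_eq_none {j k : Fin n} {b : Bool} {u : Input n} :
    wireInput j b u = (k, none) ↔ u = (k, none) ∧ k ≠ j := by
  obtain ⟨i, _ | c⟩ := u
  · by_cases h : i = j <;> simp [wireInput, h]
    all_goals rintro rfl; simp [h]
  · simp [wireInput]

theorem mem_map_wireInput {j k : Fin n} {b : Bool} {ins : List (Input n)} :
    (k, none) ∈ ins.map (wireInput j b) ↔ (k, none) ∈ ins ∧ k ≠ j := by
  simp [List.mem_map, wireInput_eq_none]

theorem occurs_hardwire (j k : Fin n) (b : Bool) (T : DTree n m) :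
    (T.hardwire j b).occurs k = true ↔ T.occurs k = true ∧ k ≠ j := by
  induction T with
  | leaf => simp [hardwire, occurs]
  | var ins K ch ih =>
    simp only [hardwire, occurs_var, ih, mem_map_wireInput, exists_and_right, or_and_right]
  | chk K ch ih => simp only [hardwire, occurs_chk, ih, exists_and_right]

theorem pairwise_map_wireInput {j : Fin n} {b : Bool} {ins : List (Input n)}
    (h : ins.Pairwise fun u v => u.2 = none → v.2 = none → u.1 ≠ v.1) :
    (ins.map (wireInput j b)).Pairwise fun u v => u.2 = none → v.2 = none → u.1 ≠ v.1 := by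
  have hw : ∀ u : Input n, (wireInput j b u).2 = none → u.2 = none := fun u hu => by
    rw [(wireInput_eq_none (k := (wireInput j b u).1).1 (Prod.ext rfl hu)).1]
  refine List.pairwise_map.2 (h.imp fun {u v} huv hu hv => ?_)
  rw [wireInput_fst, wireInput_fst]
  exact huv (hw u hu) (hw v hv)

theorem Decoupled.hardwire (j : Fin n) (b : Bool) {T : DTree n m} (hT : T.Decoupled) :
    (T.hardwire j b).Decoupled := by
  induction T with
  | leaf => trivial
  | chk K ch ih => exact fun a => ih a (hT a)
  | var ins K ch ih =>
    obtain ⟨h1, h2, h3, h4⟩ := hT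
    refine ⟨pairwise_map_wireInput h1, fun k hk a ha => ?_, fun a c k hac ha hc => ?_,
      fun a => ih a (h4 a)⟩
    · exact h2 k (mem_map_wireInput.1 hk).1 a ((occurs_hardwire _ _ _ _).1 ha).1
    · exact h3 a c k hac ((occurs_hardwire _ _ _ _).1 ha).1 ((occurs_hardwire _ _ _ _).1 hc).1

/-- Pivoting at an AND node adds no live bit to the node, since `x_j` occurred there already. -/
theorem occurs_pivot (j k : Fin n) {ins : List (Input n)} {K : ℕ} {ch : Fin K → DTree n m}
    (hj : (var ins K ch).occurs j = true) :
    ((var ins K ch).pivot j).occurs k = (var ins K ch).occurs k := by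
  rw [Bool.eq_iff_iff, pivot, occurs_chk, Fin.exists_fin_two, Matrix.cons_val_zero,
    Matrix.cons_val_one, Matrix.cons_val_fin_one, occurs_hardwire, occurs_var, occurs_var]
  simp only [List.mem_cons, mem_map_wireInput, occurs_hardwire]
  rw [occurs_var] at hj
  by_cases h : k = j
  · subst h; simpa using hj
  · simp [h]

/-- Pivoting on `x_j` needs an AND node that is decoupled up to occurrences of `x_j` only. -/
theorem decoupled_pivot (j : Fin n) {ins : List (Input n)} {K : ℕ} {ch : Fin K → DTree n m}
    (h1 : ins.Pairwise fun u v => u.2 = none → v.2 = none → u.1 ≠ v.1)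
    (h2 : ∀ k, k ≠ j → (k, none) ∈ ins → ∀ a, ¬ (ch a).occurs k = true)
    (h3 : ∀ a b k, k ≠ j → a ≠ b → (ch a).occurs k = true → ¬ (ch b).occurs k = true)
    (h4 : ∀ a, (ch a).Decoupled) : ((var ins K ch).pivot j).Decoupled := by
  have key : ∀ b, ((var ins K ch).hardwire j b).Decoupled := fun b => by
    refine ⟨pairwise_map_wireInput h1, fun k hk a ha => ?_, fun a c k hac ha hc => ?_,
      fun a => (h4 a).hardwire j b⟩
    · obtain ⟨hk, hkj⟩ := mem_map_wireInput.1 hk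
      exact h2 k hkj hk a ((occurs_hardwire _ _ _ _).1 ha).1
    · obtain ⟨ha, hkj⟩ := (occurs_hardwire _ _ _ _).1 ha
      exact h3 a c k hkj hac ha ((occurs_hardwire _ _ _ _).1 hc).1
  refine Fin.forall_fin_two.2 ⟨key false, ?_⟩
  obtain ⟨k1, k2, k3, k4⟩ := key true
  refine ⟨List.pairwise_cons.2 ⟨fun u hu _ hu2 => ?_, k1⟩, fun k hk a ha => ?_, k3, k4⟩
  · rintro rfl
    exact (mem_map_wireInput.1 (show ((_, none) : Input n) ∈ _ by rw [← hu2]; exact hu)).2 rfl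
  · rcases List.mem_cons.1 hk with hk | hk
    · exact ((occurs_hardwire _ _ _ _).1 ha).2 (congrArg Prod.fst hk)
    · exact k2 k hk a ha

theorem pairwise_length_inits {α : Type*} (p : List α) :
    p.inits.Pairwise fun r s => r.length < s.length := by
  induction p with
  | nil => simp
  | cons a p ih => simpa [List.inits_cons, List.pairwise_map] using ih

/-- `yca` returns the deepest initial segment of the address below which `x_j` occurs. -/
theorem yca_spec {T : DTree n m} {j : Fin n} {p r : List ℕ} (h : T.yca j p = some r) :
    ∃ q S, p = r ++ q ∧ T.sub r = some S ∧ S.occurs j = true ∧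
      ∀ a q' C, q = a :: q' → S.sub [a] = some C → ¬ C.occurs j = true := by
  unfold yca at h
  obtain ⟨hr, as, bs, hl, has⟩ := List.find?_eq_some_iff_append.1 h
  have hmem : r ∈ p.inits := by rw [← List.mem_reverse, hl]; simp
  obtain ⟨q, rfl⟩ := (List.mem_inits _ _).1 hmem
  split at hr
  · rename_i S hS
    refine ⟨q, S, rfl, hS, hr, ?_⟩
    rintro a q' C rfl hC hCj
    have hsub : T.sub (r ++ [a]) = some C := by rw [sub_append, hS]; exact hC
    have hne : r ++ [a] ∉ as := fun hm => by simpa [hsub, hCj] using has _ hm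
    have hpw := List.pairwise_reverse.2 (pairwise_length_inits (r ++ a :: q'))
    rw [hl] at hpw
    have hmem : r ++ [a] ∈ as ++ r :: bs := by
      rw [← hl, List.mem_reverse, List.mem_inits]
      exact ⟨q', by simp⟩
    rcases List.mem_append.1 hmem with hm | hm
    · exact hne hm
    rcases List.mem_cons.1 hm with hm | hm
    · simp at hm
    · have := (List.pairwise_cons.1 (List.pairwise_append.1 hpw).2.1).1 _ hm
      simp at this
  · simp at hr

theorem not_occurs_of_yca_eq_none {T : DTree n m} {j : Fin n} {p : List ℕ}
    (h : T.yca j p = none) : ¬ T.occurs j = true := by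
  have := List.find?_eq_none.1 h [] (by simp)
  cases T <;> simpa [sub] using this

/-- The ancestors of the `yca` node keep their live bits, as `x_j` occurred below them already; on
the way from that node down to the leaf, `x_j` is new. -/
theorem Decoupled.step (H : Matrix (Fin m) (Fin n) (ZMod 2)) (p : List ℕ) {T : DTree n m}
    (hT : T.Decoupled) : (T.step H p).Decoupled := by
  unfold DTree.step
  split
  · rename_i j par hs
    split
    · rename_i hy
      exact hT.modifyAt_expand H hs fun _ => not_occurs_of_yca_eq_none hy
    · rename_i r hy
      obtain ⟨q, S, rfl, hS, hSj, hC⟩ := yca_spec hy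
      rw [sub_append, hS, Option.bind_some] at hs
      split
      · rename_i ins K ch hv
        obtain rfl : S = var ins K ch := by simpa [hS] using hv
        rw [modifyAt_append, modifyAt_modifyAt]
        obtain _ | ⟨a, q⟩ := q
        · simp [sub] at hs
        obtain ⟨h, hs'⟩ := sub_var_cons.1 hs
        have hCj : ¬ (ch ⟨a, h⟩).occurs j = true :=
          hC a q _ rfl (sub_var_cons.2 ⟨h, by cases ch ⟨a, h⟩ <;> rfl⟩)
        refine hT.modifyAt hS (fun k => ?_) fun hd => ?_
        · rw [DTree.modifyAt, occurs_pivot]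
          · rw [Bool.eq_iff_iff, ← DTree.modifyAt, occurs_modifyAt_expand H hs]
            exact or_iff_left_of_imp fun hk => hk.1 ▸ hSj
          · rw [← DTree.modifyAt, occurs_modifyAt_expand H hs]
            exact .inl hSj
        · have ho : ∀ b k', k' ≠ j →
              (if b.val = a then DTree.modifyAt (expand H) q (ch b) else ch b).occurs k' = true →
                (ch b).occurs k' = true := by
            intro b k' hk hb
            split at hb
            · obtain rfl : b = ⟨a, h⟩ := Fin.ext (by assumption)
              exact ((occurs_modifyAt_expand H hs' k').1 hb).resolve_right fun h => hk h.1
            · exact hb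
          obtain ⟨h1, h2, h3, h4⟩ := hd
          rw [DTree.modifyAt]
          refine decoupled_pivot j h1 (fun k hk hm b hb => h2 k hm b (ho b k hk hb))
            (fun b c k hk hbc hb hc => h3 b c k hbc (ho b k hk hb) (ho c k hk hc)) fun b => ?_
          split
          · obtain rfl : b = ⟨a, h⟩ := Fin.ext (by assumption)
            exact (h4 _).modifyAt_expand H hs' fun _ => hCj
          · exact h4 b
      · rename_i hv
        rw [modifyAt_append]
        refine hT.modifyAt hS (fun k => ?_) fun hd => ?_
        · rw [Bool.eq_iff_iff, occurs_modifyAt_expand H hs]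
          exact or_iff_left_of_imp fun hk => hk.1 ▸ hSj
        cases S with
        | leaf => simp [occurs] at hSj
        | var ins K ch => exact (hv _ _ _ hS).elim
        | chk K ch =>
          obtain _ | ⟨a, q⟩ := q
          · simp [sub] at hs
          obtain ⟨h, hs'⟩ := sub_chk_cons.1 hs
          have hCj : ¬ (ch ⟨a, h⟩).occurs j = true :=
            hC a q _ rfl (sub_chk_cons.2 ⟨h, by cases ch ⟨a, h⟩ <;> rfl⟩)
          intro b
          dsimp only
          split
          · obtain rfl : b = ⟨a, h⟩ := Fin.ext (by assumption)
            exact (hd _).modifyAt_expand H hs' fun _ => hCj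
          · exact hd b
  · rename_i hs
    exact hT.modifyAt_expand H hs (by simp)
  · exact hT

end DTree

/-! ### Independence and positive correlation under the erasure measure -/

/-- The probability of an erasure pattern. -/
noncomputable def becWeight {n : ℕ} (ε : ℝ) (x : Fin n → Bool) : ℝ :=
  ∏ k, if x k = true then ε else 1 - ε

/-- Expectation of a real-valued function of the erasure pattern. -/
noncomputable def realExpect {n : ℕ} (ε : ℝ) (f : (Fin n → Bool) → ℝ) : ℝ :=
  ∑ x, becWeight ε x * f x

/-- The function `f` depends only on the coordinates in `s`. -/
def DependsOnlyOn {n : ℕ} (f : (Fin n → Bool) → ℝ) (s : Set (Fin n)) : Prop :=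
  ∀ x y : Fin n → Bool, (∀ k ∈ s, x k = y k) → f x = f y

section Expectation

variable {n : ℕ} {ε : ℝ}

theorem DependsOnlyOn.mono {f : (Fin n → Bool) → ℝ} {s t : Set (Fin n)} (hf : DependsOnlyOn f s)
    (hst : s ⊆ t) : DependsOnlyOn f t :=
  fun x y h => hf x y fun k hk => h k (hst hk)

theorem becWeight_nonneg (h0 : 0 ≤ ε) (h1 : ε ≤ 1) (x : Fin n → Bool) : 0 ≤ becWeight ε x := by
  refine Finset.prod_nonneg fun k _ => ?_
  split <;> linarith

theorem realExpect_prod (g : Fin n → Bool → ℝ) :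
    realExpect ε (fun x => ∏ k, g k (x k)) = ∏ k, (ε * g k true + (1 - ε) * g k false) := by
  simp only [realExpect, becWeight, ← Finset.prod_mul_distrib]
  have := (Finset.prod_univ_sum (fun _ : Fin n => (Finset.univ : Finset Bool))
    (fun k b => (if b = true then ε else 1 - ε) * g k b)).symm
  rw [Fintype.piFinset_univ] at this
  rw [this]
  simp

theorem realExpect_const (c : ℝ) : realExpect ε (fun _ : Fin n → Bool => c) = c := by
  have h := realExpect_prod (n := n) (ε := ε) (fun _ _ => 1)
  simp only [Finset.prod_const_one, mul_one, add_sub_cancel, realExpect] at h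
  rw [realExpect, ← Finset.sum_mul, h, one_mul]

theorem realExpect_mono (h0 : 0 ≤ ε) (h1 : ε ≤ 1) {f g : (Fin n → Bool) → ℝ}
    (h : ∀ x, f x ≤ g x) : realExpect ε f ≤ realExpect ε g :=
  Finset.sum_le_sum fun x _ => mul_le_mul_of_nonneg_left (h x) (becWeight_nonneg h0 h1 x)

theorem realExpect_one_sub (f : (Fin n → Bool) → ℝ) :
    realExpect ε (fun x => 1 - f x) = 1 - realExpect ε f := by
  have := realExpect_const (n := n) (ε := ε) 1
  simp only [realExpect, mul_sub, Finset.sum_sub_distrib] at this ⊢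
  rw [this]

/-- Functions of disjoint sets of bits are independent: in the double sum over `(x, y)` that
expands the product of the expectations, exchange the coordinates of `x` and `y` outside `s`. -/
theorem realExpect_mul {f g : (Fin n → Bool) → ℝ} {s t : Set (Fin n)} (hf : DependsOnlyOn f s)
    (hg : DependsOnlyOn g t) (hst : Disjoint s t) :
    realExpect ε (fun x => f x * g x) = realExpect ε f * realExpect ε g := by
  classical
  let σ : (Fin n → Bool) × (Fin n → Bool) → (Fin n → Bool) × (Fin n → Bool) := fun z =>
    (fun k => if k ∈ s then z.1 k else z.2 k, fun k => if k ∈ s then z.2 k else z.1 k)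
  have hσ : Function.Involutive σ := fun z => by
    ext k <;> by_cases hk : k ∈ s <;> simp [σ, hk]
  have h1 : ∑ y : Fin n → Bool, becWeight ε y = 1 := by
    simpa [realExpect] using realExpect_const (n := n) (ε := ε) 1
  calc realExpect ε (fun x => f x * g x)
      = ∑ z : (Fin n → Bool) × (Fin n → Bool),
          becWeight ε z.1 * becWeight ε z.2 * (f z.1 * g z.1) := by
        rw [Fintype.sum_prod_type]
        refine Finset.sum_congr rfl fun x _ => ?_
        dsimp only
        rw [← Finset.sum_mul, ← Finset.mul_sum, h1, mul_one]
    _ = ∑ z : (Fin n → Bool) × (Fin n → Bool),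
          becWeight ε z.1 * becWeight ε z.2 * (f z.1 * g z.2) := by
        refine Fintype.sum_equiv hσ.toPerm _ _ fun z => ?_
        have hw : becWeight ε (σ z).1 * becWeight ε (σ z).2 =
            becWeight ε z.1 * becWeight ε z.2 := by
          simp only [becWeight, ← Finset.prod_mul_distrib]
          refine Finset.prod_congr rfl fun k _ => ?_
          by_cases hk : k ∈ s <;> simp [σ, hk, mul_comm]
        have hfz : f (σ z).1 = f z.1 := hf _ _ fun k hk => by simp [σ, hk]
        have hgz : g (σ z).2 = g z.1 := hg _ _ fun k hk => by
          have : k ∉ s := fun h => Set.disjoint_left.1 hst h hk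
          simp [σ, this]
        rw [Function.Involutive.coe_toPerm, hw, hfz, hgz]
    _ = realExpect ε f * realExpect ε g := by
        rw [Fintype.sum_prod_type, realExpect, realExpect, Finset.sum_mul_sum]
        exact Finset.sum_congr rfl fun x _ => Finset.sum_congr rfl fun y _ => by ring

/-- Harris' inequality, for decreasing functions written as `1 - f` and `1 - g`. -/
theorem realExpect_mul_one_sub_le (h0 : 0 ≤ ε) (h1 : ε ≤ 1) {f g : (Fin n → Bool) → ℝ}
    (hf : Monotone f) (hg : Monotone g) (hf0 : 0 ≤ f) (hg0 : 0 ≤ g) :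
    realExpect ε (fun x => 1 - f x) * realExpect ε (fun x => 1 - g x) ≤
      realExpect ε (fun x => (1 - f x) * (1 - g x)) := by
  have hμ : ∀ x y : Fin n → Bool, becWeight ε x * becWeight ε y ≤
      becWeight ε (x ⊓ y) * becWeight ε (x ⊔ y) := fun x y => by
    simp only [becWeight, ← Finset.prod_mul_distrib]
    have hb : ∀ a b : Bool, (if a = true then ε else 1 - ε) * (if b = true then ε else 1 - ε) =
        (if a ⊓ b = true then ε else 1 - ε) * (if a ⊔ b = true then ε else 1 - ε) := by
      intro a b
      cases a <;> cases b <;> simp [mul_comm]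
    exact (Finset.prod_congr rfl fun k _ => hb (x k) (y k)).le
  have key := fkg (μ := becWeight ε) (f := f) (g := g) (becWeight_nonneg h0 h1) hf0 hg0 hf hg hμ
  have hone := realExpect_const (n := n) (ε := ε) 1
  have hexp : realExpect ε (fun x => (1 - f x) * (1 - g x)) =
      1 - realExpect ε f - realExpect ε g + realExpect ε (fun x => f x * g x) := by
    refine Eq.trans ?_ (congrArg (· - _ - _ + _) hone)
    simp only [realExpect, ← Finset.sum_sub_distrib, ← Finset.sum_add_distrib]
    exact Finset.sum_congr rfl fun x _ => by ring
  rw [realExpect_one_sub, realExpect_one_sub, hexp]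
  simp only [realExpect, mul_one] at key hone ⊢
  rw [hone] at key
  linarith

end Expectation

/-! ### The expected value of a decoupled tree -/

namespace DTree

variable {n m : ℕ}

/-- The value in `{0, 1}` of the tree under the erasure pattern `x`, with the remaining leaves set
to `1` except those hardwired to `0`, written with the real polynomials of AND and OR. -/
def value (x : Fin n → Bool) : DTree n m → ℝ
  | leaf _ _ (some false) => 0
  | leaf _ _ _ => 1
  | var ins _ ch => (ins.map fun u => if inputVal x u = true then 1 else 0).prod *
      ∏ a, (ch a).value x
  | chk _ ch => 1 - ∏ a, (1 - (ch a).value x)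

/-- Setting the remaining leaves to `1` does not lower the value of the tree; a leaf hardwired to
`0` is false in both readings. -/
theorem value_eq_one {H : Matrix (Fin m) (Fin n) (ZMod 2)} {x : Fin n → Bool} {T : DTree n m}
    (h : T.Holds H x) : T.value x = 1 := by
  induction T with
  | leaf j par w => obtain _ | _ | _ := w <;> simp_all [Holds, inputVal, value]
  | var ins k ch ih =>
    rw [value, List.prod_eq_one, Finset.prod_eq_one fun a _ => ih a (h.2 a), one_mul]
    intro y hy
    obtain ⟨u, hu, rfl⟩ := List.mem_map.1 hy
    simp [h.1 u hu]
  | chk k ch ih =>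
    obtain ⟨a, ha⟩ := h
    rw [value, Finset.prod_eq_zero (Finset.mem_univ a) (by rw [ih a ha, sub_self]), sub_zero]

theorem one_sub_prod_mem_Icc {k : ℕ} {f : Fin k → ℝ} (h : ∀ a, f a ∈ Set.Icc (0 : ℝ) 1) :
    1 - ∏ a, (1 - f a) ∈ Set.Icc (0 : ℝ) 1 := by
  have h0 : 0 ≤ ∏ a, (1 - f a) := Finset.prod_nonneg fun a _ => sub_nonneg.2 (h a).2
  have h1 : ∏ a, (1 - f a) ≤ 1 := Finset.prod_le_one (fun a _ => sub_nonneg.2 (h a).2)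
    fun a _ => sub_le_self _ (h a).1
  constructor <;> linarith

theorem list_prod_mem_Icc {α : Type*} {f : α → ℝ} (h : ∀ a, f a ∈ Set.Icc (0 : ℝ) 1)
    (l : List α) : (l.map f).prod ∈ Set.Icc (0 : ℝ) 1 := by
  induction l with
  | nil => simp
  | cons a l ih =>
    rw [List.map_cons, List.prod_cons]
    exact ⟨mul_nonneg (h a).1 ih.1, mul_le_one₀ (h a).2 ih.1 ih.2⟩

theorem prod_mem_Icc {k : ℕ} {f : Fin k → ℝ} (h : ∀ a, f a ∈ Set.Icc (0 : ℝ) 1) :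
    ∏ a, f a ∈ Set.Icc (0 : ℝ) 1 :=
  ⟨Finset.prod_nonneg fun a _ => (h a).1, Finset.prod_le_one (fun a _ => (h a).1) fun a _ => (h a).2⟩

theorem ub_mem_Icc {ε : ℝ} (h0 : 0 ≤ ε) (h1 : ε ≤ 1) (T : DTree n m) :
    T.ub ε ∈ Set.Icc (0 : ℝ) 1 := by
  induction T with
  | leaf j par w => obtain _ | _ | _ := w <;> simp [ub]
  | chk k ch ih => rw [ub]; exact one_sub_prod_mem_Icc ih
  | var ins k ch ih =>
    have hi : ∀ u : Input n, inputProb ε u ∈ Set.Icc (0 : ℝ) 1 := by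
      rintro ⟨_, _ | _ | _⟩ <;> simp [inputProb, h0, h1]
    have ha := list_prod_mem_Icc hi ins
    have hb := prod_mem_Icc ih
    rw [ub]
    exact ⟨mul_nonneg ha.1 hb.1, mul_le_one₀ ha.2 hb.1 hb.2⟩

theorem inputValue_mem_Icc (x : Fin n → Bool) (u : Input n) :
    (if inputVal x u = true then (1 : ℝ) else 0) ∈ Set.Icc (0 : ℝ) 1 := by
  split <;> simp

theorem value_mem_Icc (x : Fin n → Bool) (T : DTree n m) : T.value x ∈ Set.Icc (0 : ℝ) 1 := by
  induction T with
  | leaf j par w => obtain _ | _ | _ := w <;> simp [value]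
  | chk k ch ih => rw [value]; exact one_sub_prod_mem_Icc ih
  | var ins k ch ih =>
    have ha := list_prod_mem_Icc (inputValue_mem_Icc x) ins
    have hb := prod_mem_Icc ih
    rw [value]
    exact ⟨mul_nonneg ha.1 hb.1, mul_le_one₀ ha.2 hb.1 hb.2⟩

theorem inputValue_mono {x y : Fin n → Bool} (h : x ≤ y) (u : Input n) :
    (if inputVal x u = true then (1 : ℝ) else 0) ≤ if inputVal y u = true then 1 else 0 := by
  obtain ⟨k, _ | b⟩ := u
  · have := h k
    revert this
    cases hx : x k <;> cases hy : y k <;> simp [inputVal, hx, hy]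
  · rfl

theorem value_mono (T : DTree n m) : Monotone fun x => T.value x := by
  intro x y hxy
  induction T with
  | leaf j par w => obtain _ | _ | _ := w <;> simp [value]
  | chk k ch ih =>
    simp only [value]
    exact sub_le_sub_left (Finset.prod_le_prod (fun a _ => sub_nonneg.2 (value_mem_Icc _ _).2)
      fun a _ => sub_le_sub_left (ih a) 1) 1
  | var ins k ch ih =>
    simp only [value]
    refine mul_le_mul ?_ (Finset.prod_le_prod (fun a _ => (value_mem_Icc _ _).1) fun a _ => ih a)
      (prod_mem_Icc fun a => value_mem_Icc _ _).1
      (list_prod_mem_Icc (inputValue_mem_Icc y) ins).1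
    clear ih
    induction ins with
    | nil => rfl
    | cons u l ihl =>
      simp only [List.map_cons, List.prod_cons]
      exact mul_le_mul (inputValue_mono hxy u) ihl (list_prod_mem_Icc (inputValue_mem_Icc x) l).1
        (inputValue_mem_Icc y u).1

theorem dependsOnlyOn_inputs (ins : List (Input n)) :
    DependsOnlyOn (fun x => (ins.map fun u => if inputVal x u = true then (1 : ℝ) else 0).prod)
      {k | (k, none) ∈ ins} := by
  intro x y h
  refine congrArg List.prod (List.map_congr_left fun u hu => ?_)
  obtain ⟨k, _ | b⟩ := u
  · have : inputVal x (k, none) = inputVal y (k, none) := h k hu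
    simp only [this]
  · rfl

theorem dependsOnlyOn_value (T : DTree n m) :
    DependsOnlyOn (fun x => T.value x) {k | T.occurs k = true} := by
  induction T with
  | leaf j par w => exact fun x y _ => by obtain _ | _ | _ := w <;> simp [value]
  | chk k ch ih =>
    intro x y h
    have : ∀ a, (ch a).value x = (ch a).value y := fun a =>
      (ih a).mono (fun k hk => occurs_chk.2 ⟨a, hk⟩) x y h
    simp only [value, this]
  | var ins k ch ih =>
    intro x y h
    have h1 : ∀ a, (ch a).value x = (ch a).value y := fun a =>
      (ih a).mono (fun k hk => occurs_var.2 (.inr ⟨a, hk⟩)) x y h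
    have h2 := (dependsOnlyOn_inputs ins).mono
      (fun k hk => (occurs_var (ch := ch)).2 (.inl hk)) x y h
    simp only [value, h1]
    exact congrArg (· * _) h2

theorem realExpect_input (ε : ℝ) (u : Input n) :
    realExpect ε (fun x => if inputVal x u = true then (1 : ℝ) else 0) = inputProb ε u := by
  obtain ⟨k, _ | _ | _⟩ := u
  · have h := realExpect_prod (n := n) (ε := ε)
      (fun i b => if i = k then (if b = true then 1 else 0) else 1)
    simp only [Finset.prod_ite_eq', Finset.mem_univ, if_true] at h
    refine h.trans ?_
    rw [Finset.prod_eq_single k] <;> simp +contextual [inputProb]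
  · simp [inputVal, inputProb, realExpect_const]
  · simp [inputVal, inputProb, realExpect_const]

theorem realExpect_inputs (ε : ℝ) {ins : List (Input n)}
    (h : ins.Pairwise fun u v => u.2 = none → v.2 = none → u.1 ≠ v.1) :
    realExpect ε (fun x => (ins.map fun u => if inputVal x u = true then (1 : ℝ) else 0).prod) =
      (ins.map (inputProb ε)).prod := by
  induction ins with
  | nil => simp [realExpect_const]
  | cons u l ih =>
    obtain ⟨hu, hl⟩ := List.pairwise_cons.1 h
    have hd : Disjoint {k | (k, none) ∈ [u]} {k | ((k, none) : Input n) ∈ l} := by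
      refine Set.disjoint_left.2 fun k hk hk' => ?_
      have hk : (k, none) = u := by simpa using hk
      exact hu _ hk' (by rw [← hk]) rfl (by rw [← hk])
    have := realExpect_mul (ε := ε) (dependsOnlyOn_inputs [u]) (dependsOnlyOn_inputs l) hd
    simp only [List.map_cons, List.prod_cons, List.map_nil, List.prod_nil, mul_one] at this ⊢
    rw [this, realExpect_input, ih hl]

/-- Children of an AND node without common live bits are independent. -/
theorem realExpect_prod_value (ε : ℝ) {k : ℕ} {ch : Fin k → DTree n m}
    (h : ∀ a b j, a ≠ b → (ch a).occurs j = true → ¬ (ch b).occurs j = true) (s : Finset (Fin k)) :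
    realExpect ε (fun x => ∏ a ∈ s, (ch a).value x) =
      ∏ a ∈ s, realExpect ε (fun x => (ch a).value x) := by
  classical
  induction s using Finset.induction_on with
  | empty => simp [realExpect_const]
  | insert a s ha ih =>
    simp only [Finset.prod_insert ha]
    rw [← ih]
    refine realExpect_mul (dependsOnlyOn_value (ch a))
      (t := {j | ∃ b ∈ s, (ch b).occurs j = true}) (fun x y hxy => ?_) ?_
    · exact Finset.prod_congr rfl fun b hb =>
        dependsOnlyOn_value (ch b) x y fun j hj => hxy j ⟨b, hb, hj⟩
    · refine Set.disjoint_left.2 fun j hj => ?_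
      rintro ⟨b, hb, hj'⟩
      exact h a b j (fun e => ha (e ▸ hb)) hj hj'

/-- Children of an OR node are positively correlated. -/
theorem le_realExpect_prod_one_sub_value {ε : ℝ} (h0 : 0 ≤ ε) (h1 : ε ≤ 1) {k : ℕ}
    (ch : Fin k → DTree n m) (s : Finset (Fin k)) :
    ∏ a ∈ s, (1 - realExpect ε (fun x => (ch a).value x)) ≤
      realExpect ε (fun x => ∏ a ∈ s, (1 - (ch a).value x)) := by
  classical
  induction s using Finset.induction_on with
  | empty => simp [realExpect_const]
  | insert a s ha ih =>
    simp only [Finset.prod_insert ha]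
    have hle : ∀ (x : Fin n → Bool), 0 ≤ ∏ b ∈ s, (1 - (ch b).value x) := fun x =>
      Finset.prod_nonneg fun b _ => sub_nonneg.2 (value_mem_Icc _ _).2
    have hle1 : ∀ (x : Fin n → Bool), ∏ b ∈ s, (1 - (ch b).value x) ≤ 1 := fun x =>
      Finset.prod_le_one (fun b _ => sub_nonneg.2 (value_mem_Icc _ _).2)
        fun b _ => sub_le_self _ (value_mem_Icc _ _).1
    have key := realExpect_mul_one_sub_le h0 h1 (value_mono (ch a))
      (g := fun x => 1 - ∏ b ∈ s, (1 - (ch b).value x))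
      (fun x y hxy => sub_le_sub_left (Finset.prod_le_prod
        (fun b _ => sub_nonneg.2 (value_mem_Icc _ _).2)
        fun b _ => sub_le_sub_left (value_mono (ch b) hxy) 1) 1)
      (fun x => (value_mem_Icc x (ch a)).1) (fun x => sub_nonneg.2 (hle1 x))
    simp only [sub_sub_cancel] at key
    refine le_trans ?_ key
    rw [realExpect_one_sub]
    refine mul_le_mul_of_nonneg_left ih (sub_nonneg.2 ?_)
    exact (realExpect_mono h0 h1 fun x => (value_mem_Icc x (ch a)).2).trans_eq (realExpect_const 1)

theorem realExpect_value_le_ub {ε : ℝ} (h0 : 0 ≤ ε) (h1 : ε ≤ 1) {T : DTree n m}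
    (hT : T.Decoupled) : realExpect ε (fun x => T.value x) ≤ T.ub ε := by
  induction T with
  | leaf j par w => obtain _ | _ | _ := w <;> simp [value, ub, realExpect_const]
  | chk k ch ih =>
    simp only [value, ub]
    rw [realExpect_one_sub]
    refine sub_le_sub_left (le_trans ?_ (le_realExpect_prod_one_sub_value h0 h1 ch Finset.univ)) 1
    exact Finset.prod_le_prod (fun a _ => sub_nonneg.2 (ub_mem_Icc h0 h1 _).2)
      fun a _ => sub_le_sub_left (ih a (hT a)) 1
  | var ins k ch ih =>
    obtain ⟨hi, hic, hc, hd⟩ := hT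
    have hprod : DependsOnlyOn (fun x => ∏ a, (ch a).value x) {j | ∃ a, (ch a).occurs j = true} :=
      fun x y hxy => Finset.prod_congr rfl fun a _ =>
        dependsOnlyOn_value (ch a) x y fun j hj => hxy j ⟨a, hj⟩
    have hdisj : Disjoint {j | ((j, none) : Input n) ∈ ins} {j | ∃ a, (ch a).occurs j = true} :=
      Set.disjoint_left.2 fun j hj ⟨a, ha⟩ => hic j hj a ha
    simp only [value, ub]
    rw [realExpect_mul (dependsOnlyOn_inputs ins) hprod hdisj, realExpect_inputs ε hi,
      realExpect_prod_value ε hc]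
    refine mul_le_mul_of_nonneg_left (Finset.prod_le_prod (fun a _ => ?_) fun a _ => ih a (hd a)) ?_
    · exact (realExpect_const (n := n) 0).symm.trans_le
        (realExpect_mono h0 h1 fun x => (value_mem_Icc x (ch a)).1)
    · refine (list_prod_mem_Icc (fun u => ?_) ins).1
      obtain ⟨_, _ | _ | _⟩ := u <;> simp [inputProb, h0, h1]

end DTree

/-! ### Termination and the bound for the trees of the algorithm -/

theorem exists_stopsAt {m n : ℕ} (H : Matrix (Fin m) (Fin n) (ZMod 2)) (i : Fin n)
    (L : LeafFinder n m) (limit : ℕ) : ∃ t, StopsAt H i L limit t := by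
  classical
  have hex : ∃ t, 1 ≤ t ∧ StopCond H i L limit t := by
    by_contra! hc
    simp only [StopCond, not_or, not_lt, not_not] at hc
    have hw : ∀ t, t ≤ (treeAt H i L (t + 1)).weight := fun t => by
      induction t with
      | zero => exact Nat.zero_le _
      | succ t ih =>
        exact ih.trans_lt (DTree.weight_lt_step H (L.isLeafAt_find _ _ (hc (t + 1) (by omega)).2))
    have h1 := hw (2 * limit + 1)
    have h2 := DTree.weight_le (treeAt H i L (2 * limit + 1 + 1))
    have h3 := (hc (2 * limit + 1 + 1) (by omega)).1
    omega
  obtain ⟨h1, h2⟩ := Nat.find_spec hex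
  exact ⟨Nat.find hex, h1, h2, fun s hs hst h => Nat.find_min hex hst ⟨hs, h⟩⟩

theorem decoupled_treeAt {m n : ℕ} (H : Matrix (Fin m) (Fin n) (ZMod 2)) (i : Fin n)
    (L : LeafFinder n m) (t : ℕ) : (treeAt H i L t).Decoupled := by
  induction t with
  | zero => trivial
  | succ t ih => exact ih.step H _

theorem holds_treeAt {m n : ℕ} {H : Matrix (Fin m) (Fin n) (ZMod 2)} {i : Fin n}
    (L : LeafFinder n m) {x : Fin n → Bool} (h : decoder H i x = true) (t : ℕ) :
    (treeAt H i L t).Holds H x := by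
  induction t with
  | zero => exact DTree.holds_leaf_of_decoder h
  | succ t ih => exact ih.step _

theorem theorem1 {m n : ℕ} (H : Matrix (Fin m) (Fin n) (ZMod 2)) (i : Fin n)
    (L : LeafFinder n m) :
    (∀ limit : ℕ, ∃ t : ℕ, StopsAt H i L limit t) ∧
      ∀ (t : ℕ) (ε : ℝ), 0 ≤ ε → ε ≤ 1 →
        bitErasureProb H i ε ≤ (treeAt H i L t).ub ε := by
  refine ⟨exists_stopsAt H i L, fun t ε h0 h1 => ?_⟩
  refine le_trans ?_ (DTree.realExpect_value_le_ub h0 h1 (decoupled_treeAt H i L t))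
  refine realExpect_mono h0 h1 (f := fun x => if decoder H i x = true then 1 else 0) fun x => ?_
  split
  · rename_i h
    exact (DTree.value_eq_one (holds_treeAt L h t)).ge
  · exact (DTree.value_mem_Icc x _).1
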